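/- Let $Q$ be a probability measure and let $X_1,X_2,\dots$ be real-valued random variables that are iid under $Q$. Let $\mathcal F_i$ be the $\sigma$-field generated by $X_1,\dots,X_i$, with $\mathcal F_0$ trivial. Let $e:\mathbb R\to[0,\infty)$ be measurable and put $E_i=e(X_i)$; for instance $e(x)=(x-\mu)_+^2/\sigma^2$ or $e(x)=2(x-\mu)_+^2/\sigma^2$, with $\mu\in\mathbb R$ and $\sigma>0$, which are the e-variables for testing mean at most $\mu$ and variance at most $\sigma^2$, without and with the additional assumption of symmetry. For $i\ge 1$ let $\lambda_i$ be $\mathcal F_{i-1}$-measurable, where $\lambda_1$ is an arbitrary constant in $[0,1/2]$ and, for $i\ge 2$, $$ \lambda_i=\Big(\operatorname*{arg\,max}_{\lambda\in[0,1)}\ \frac1{i-1}\sum_{j=1}^{i-1}\log(1-\lambda+\lambda E_j)\Big)\wedge\frac12 . $$ Here any ($\mathcal F_{i-1}$-measurable) choice of maximizer is allowed if there are several, and the argmax is read as $1$, so that $\lambda_i=\frac12$, if the supremum over $[0,1)$ is not attained. Let $$ M_t=\prod_{i=1}^t(1-\lambda_i+\lambda_iE_i),\qquad t\ge1 . $$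 Then $$ \lim_{n\to\infty}Q\Big(\sup_{1\le t\le n}M_t\ge \frac1\alpha\Big)= 1\quad\text{for every }\alpha\in(0,1) $$ if and only if $\mathbb E^Q[E_1]>1$, where $\mathbb E^Q[E_1]\in[0,\infty]$. -/

import Mathlib

open MeasureTheory ProbabilityTheory Filter Topology

/-!
Observations are indexed from `0`: `X i` is the observation usually written `X_{i+1}`,
`lam i` is the bet `λ_{i+1}` placed on it, and "the past of `i`" means `X 0, …, X (i - 1)`.
-/

/-- The σ-algebra generated by the first `i` observations (trivial for `i = 0`). -/
abbrev pastSigma {Ω : Type*} (X : ℕ → Ω → ℝ) (i : ℕ) : MeasurableSpace Ω :=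
  ⨆ j ∈ Finset.range i, MeasurableSpace.comap (X j) inferInstance

/-- The empirical growth rate of the constant bet `l` on the first `i` e-values `x 0, …, x (i-1)`.
For `l ∈ [0,1)` and nonnegative `x` the argument of the logarithm is positive.
For `i = 0` this is identically `0`. -/
noncomputable def empGrowth (x : ℕ → ℝ) (i : ℕ) (l : ℝ) : ℝ :=
  1 / (i : ℝ) * ∑ j ∈ Finset.range i, Real.log (1 - l + l * x j)

/-- `l` is a maximizer of the empirical growth rate over `[0,1)`. -/
def IsGrowthArgmax (x : ℕ → ℝ) (i : ℕ) (l : ℝ) : Prop :=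
  l ∈ Set.Ico (0 : ℝ) 1 ∧ IsMaxOn (empGrowth x i) (Set.Ico 0 1) l

/-- `b = (argmax over [0,1) of the empirical growth rate) ∧ 1/2`.
If there are several maximizers, any of them may be used. If there is none, the supremum
over `[0,1)` is approached only as `l → 1`; the argmax is then read as `1`, so `b = 1/2`. -/
def IsCappedArgmax (x : ℕ → ℝ) (i : ℕ) (b : ℝ) : Prop :=
  (∃ l, IsGrowthArgmax x i l ∧ b = min l (1 / 2)) ∨
    ((¬ ∃ l, IsGrowthArgmax x i l) ∧ b = 1 / 2)

/-- `lam` is an e-GREE betting sequence for the data `X` and the e-values `E`: each bet is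
measurable with respect to the past and is a capped maximizer of the past growth rate.
The first bet is a constant in `[0, 1/2]`. -/
def IsEGree {Ω : Type*} (X E lam : ℕ → Ω → ℝ) : Prop :=
  ∀ i, Measurable[pastSigma X i] (lam i) ∧
    ∀ ω, IsCappedArgmax (fun j => E j ω) i (lam i ω)

/-- The e-process `M_t = ∏_{i ≤ t} (1 - λ_i + λ_i E_i)` built from the first `t` e-values. -/
noncomputable def eProc {Ω : Type*} (E lam : ℕ → Ω → ℝ) (t : ℕ) (ω : Ω) : ℝ :=
  ∏ i ∈ Finset.range t, (1 - lam i ω + lam i ω * E i ω)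

/-! If the mean is at most 1, the wealth is a nonnegative supermartingale, so Ville's inequality
(`measure_exists_le_eProc_le`) keeps the crossing probability below `α`, away from 1.

If the mean exceeds 1, possibly infinite, the expected log-growth has positive slope at some small
bet `d` (`exists_integral_slope_pos`). This slope and a curvature weight are bounded functions of
the data, so the strong law applies to both, and the rest is pathwise (`tendsto_wealth_atTop`). By
concavity the capped argmax maximizes past growth over `[0, 1/2]`, so the strategy is
follow-the-leader. Positive slope at `d` eventually keeps the bets above `d` and makes the best
constant bet grow linearly. Betting with one step of foresight does at least as well
(`growthSum_le_sum_foresight`), and strong concavity makes the loss from lacking foresight `O(1/n)`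
per step (`foresight_gain_le`), so the actual log-wealth also grows linearly. -/

/-- The total log-growth of the constant bet `l` on the first `n` e-values. -/
noncomputable def growthSum (x : ℕ → ℝ) (n : ℕ) (l : ℝ) : ℝ :=
  ∑ j ∈ Finset.range n, Real.log (1 - l + l * x j)

theorem wealth_pos {l y : ℝ} (hl : 0 ≤ l) (hl1 : l < 1) (hy : 0 ≤ y) : 0 < 1 - l + l * y := by
  have := mul_nonneg hl hy
  linarith

theorem growthSum_succ (x : ℕ → ℝ) (n : ℕ) (l : ℝ) :
    growthSum x (n + 1) l = growthSum x n l + Real.log (1 - l + l * x n) :=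
  Finset.sum_range_succ _ _

theorem empGrowth_eq (x : ℕ → ℝ) (n : ℕ) (l : ℝ) :
    empGrowth x n l = 1 / (n : ℝ) * growthSum x n l := rfl

theorem empGrowth_le_iff (x : ℕ → ℝ) (n : ℕ) (l l' : ℝ) :
    empGrowth x n l ≤ empGrowth x n l' ↔ growthSum x n l ≤ growthSum x n l' := by
  rcases Nat.eq_zero_or_pos n with rfl | hn
  · simp [empGrowth, growthSum]
  · rw [empGrowth_eq, empGrowth_eq]
    exact mul_le_mul_iff_of_pos_left (by positivity)

/-! ### Concavity of the growth curve and the capped argmax -/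

theorem concaveOn_log_wealth {y : ℝ} (hy : 0 ≤ y) :
    ConcaveOn ℝ (Set.Ico (0 : ℝ) 1) (fun l => Real.log (1 - l + l * y)) := by
  refine ⟨convex_Ico 0 1, fun a ha b hb s t hs ht hst => ?_⟩
  have h := strictConcaveOn_log_Ioi.concaveOn.2 (wealth_pos ha.1 ha.2 hy)
    (wealth_pos hb.1 hb.2 hy) hs ht hst
  refine h.trans_eq (congrArg Real.log ?_)
  simp only [smul_eq_mul]
  linear_combination hst

theorem concaveOn_growthSum {x : ℕ → ℝ} (hx : ∀ j, 0 ≤ x j) (n : ℕ) :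
    ConcaveOn ℝ (Set.Ico (0 : ℝ) 1) (growthSum x n) := by
  induction n with
  | zero =>
    have h : growthSum x 0 = fun _ => 0 := by funext l; simp [growthSum]
    rw [h]
    exact concaveOn_const 0 (convex_Ico 0 1)
  | succ n ih =>
    have h : growthSum x (n + 1) = growthSum x n + fun l => Real.log (1 - l + l * x n) := by
      funext l; exact growthSum_succ x n l
    rw [h]
    exact ih.add (concaveOn_log_wealth (hx n))

theorem continuousOn_growthSum {x : ℕ → ℝ} (hx : ∀ j, 0 ≤ x j) (n : ℕ) :
    ContinuousOn (growthSum x n) (Set.Ico (0 : ℝ) 1) := by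
  unfold growthSum
  refine continuousOn_finsetSum _ fun j _ => ContinuousOn.log (by fun_prop) fun l hl => ?_
  exact (wealth_pos hl.1 hl.2 (hx j)).ne'

/-- Between two points a concave growth curve is at least its smaller end value. -/
theorem min_growthSum_le {x : ℕ → ℝ} (hx : ∀ j, 0 ≤ x j) (n : ℕ) {a m b : ℝ}
    (ha : 0 ≤ a) (ham : a ≤ m) (hmb : m ≤ b) (hb : b < 1) :
    min (growthSum x n a) (growthSum x n b) ≤ growthSum x n m := by
  have hab : a ≤ b := ham.trans hmb
  refine (concaveOn_growthSum hx n).min_le_of_mem_segment ⟨ha, hab.trans_lt hb⟩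
    ⟨ha.trans hab, hb⟩ ?_
  rw [segment_eq_Icc hab]
  exact ⟨ham, hmb⟩

/-- A capped argmax lies in `[0, 1/2]` and maximizes the growth over that interval. -/
theorem IsCappedArgmax.isMaxOn {x : ℕ → ℝ} (hx : ∀ j, 0 ≤ x j) {n : ℕ} {b : ℝ}
    (h : IsCappedArgmax x n b) :
    b ∈ Set.Icc (0 : ℝ) (1 / 2) ∧ IsMaxOn (growthSum x n) (Set.Icc 0 (1 / 2)) b := by
  rcases h with ⟨l, ⟨hl, hmax⟩, rfl⟩ | ⟨hno, rfl⟩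
  · refine ⟨⟨le_min hl.1 (by norm_num), min_le_right _ _⟩, fun y hy => ?_⟩
    have hyl : growthSum x n y ≤ growthSum x n l :=
      (empGrowth_le_iff x n y l).1 (hmax ⟨hy.1, by linarith [hy.2]⟩)
    rcases le_total l (1 / 2) with hl2 | hl2
    · rwa [Set.mem_ofPred_eq, min_eq_left hl2]
    -- The cap `1/2` lies between `y` and the maximizer `l`, so growth there is at least the smaller
    -- end value, the one at `y`.
    · have := min_growthSum_le hx n hy.1 hy.2 hl2 hl.2
      rw [min_eq_left hyl] at this
      rwa [Set.mem_ofPred_eq, min_eq_right hl2]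
  · refine ⟨by norm_num, fun y hy => ?_⟩
    have hsub : Set.Icc (0 : ℝ) (1 / 2) ⊆ Set.Ico 0 1 := fun z hz => ⟨hz.1, by linarith [hz.2]⟩
    obtain ⟨z, hz, hzmax⟩ := isCompact_Icc.exists_isMaxOn (Set.nonempty_of_mem hy)
      ((continuousOn_growthSum hx n).mono hsub)
    by_contra hlt
    -- If `1/2` is beaten by the best bet `z` in `[0, 1/2]`, concavity keeps every bet beyond `1/2`
    -- below `z` too, so `z` would be a maximizer over `[0, 1)`.
    have hlt' : growthSum x n (1 / 2) < growthSum x n z := (not_le.1 hlt).trans_le (hzmax hy)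
    refine hno ⟨z, hsub hz, fun w hw => (empGrowth_le_iff x n w z).2 ?_⟩
    rcases le_total w (1 / 2) with hw2 | hw2
    · exact hzmax ⟨hw.1, hw2⟩
    · by_contra hwz
      have := min_growthSum_le hx n hz.1 hz.2 hw2 hw.2
      rw [min_eq_left (not_le.1 hwz).le] at this
      exact absurd this (not_le.2 hlt')

/-! ### Tangent, Lipschitz and strong concavity estimates -/

/-- Tangent bound for the log-growth at the bet `d`. -/
theorem log_wealth_le {d l y : ℝ} (hd : 0 ≤ d) (hd1 : d < 1) (hl : 0 ≤ l) (hl1 : l < 1)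
    (hy : 0 ≤ y) :
    Real.log (1 - l + l * y) ≤
      Real.log (1 - d + d * y) + (l - d) * ((y - 1) / (1 - d + d * y)) := by
  have hp := wealth_pos hl hl1 hy
  have hq := wealth_pos hd hd1 hy
  have h := Real.log_le_sub_one_of_pos (div_pos hp hq)
  rw [Real.log_div hp.ne' hq.ne'] at h
  have h2 : (1 - l + l * y) / (1 - d + d * y) - 1 = (l - d) * ((y - 1) / (1 - d + d * y)) := by
    rw [div_sub_one hq.ne', ← mul_div_assoc]
    congr 1
    ring
  linarith

theorem growthSum_le {x : ℕ → ℝ} (hx : ∀ j, 0 ≤ x j) (n : ℕ) {d l : ℝ}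
    (hd : 0 ≤ d) (hd1 : d < 1) (hl : 0 ≤ l) (hl1 : l < 1) :
    growthSum x n l ≤ growthSum x n d +
      (l - d) * ∑ j ∈ Finset.range n, (x j - 1) / (1 - d + d * x j) := by
  unfold growthSum
  rw [Finset.mul_sum, ← Finset.sum_add_distrib]
  exact Finset.sum_le_sum fun j _ => log_wealth_le hd hd1 hl hl1 (hx j)

/-- Lipschitz bound for the log-growth over bets bounded away from `0`. -/
theorem log_wealth_sub_le {d a b y : ℝ} (hd : 0 < d) (ha : a ∈ Set.Icc d (1 / 2))
    (hb : b ∈ Set.Icc d (1 / 2)) (hy : 0 ≤ y) :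
    Real.log (1 - b + b * y) - Real.log (1 - a + a * y) ≤ |b - a| / d := by
  have ha0 : 0 < a := hd.trans_le ha.1
  have hp := wealth_pos ha0.le (by linarith [ha.2]) hy
  have h := log_wealth_le (d := a) (l := b) ha0.le (by linarith [ha.2])
    (hd.le.trans hb.1) (by linarith [hb.2]) hy
  have h1 : |(y - 1) / (1 - a + a * y)| ≤ 1 / d := by
    rw [abs_div, abs_of_pos hp, div_le_div_iff₀ hp hd]
    have h3 : d * y ≤ a * y := mul_le_mul_of_nonneg_right ha.1 hy
    have h4 : |y - 1| ≤ y + 1 := abs_le.2 ⟨by linarith, by linarith⟩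
    have h5 : |y - 1| * d ≤ (y + 1) * d := mul_le_mul_of_nonneg_right h4 hd.le
    linarith [ha.1, ha.2]
  have h2 : (b - a) * ((y - 1) / (1 - a + a * y)) ≤ |b - a| * (1 / d) :=
    (le_abs_self _).trans (by rw [abs_mul]; gcongr)
  rw [mul_one_div] at h2
  linarith

/-- Midpoint form of the strong concavity of the log-growth. -/
theorem log_wealth_midpoint {a b y : ℝ} (ha : a ∈ Set.Icc (0 : ℝ) (1 / 2))
    (hb : b ∈ Set.Icc (0 : ℝ) (1 / 2)) (hy : 0 ≤ y) :
    Real.log (1 - a + a * y) + Real.log (1 - b + b * y) +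
        (b - a) ^ 2 / 8 * ((y - 1) ^ 2 / (1 + y) ^ 2) ≤
      2 * Real.log (1 - (a + b) / 2 + (a + b) / 2 * y) := by
  have hp := wealth_pos ha.1 (by linarith [ha.2]) hy
  have hq := wealth_pos hb.1 (by linarith [hb.2]) hy
  have hm := wealth_pos (l := (a + b) / 2) (by linarith [ha.1, hb.1])
    (by linarith [ha.2, hb.2]) hy
  have hp1 : 1 - a + a * y ≤ 1 + y := by
    nlinarith [mul_nonneg (by linarith [ha.2] : (0 : ℝ) ≤ 1 - a) hy, ha.1]
  have hq1 : 1 - b + b * y ≤ 1 + y := by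
    nlinarith [mul_nonneg (by linarith [hb.2] : (0 : ℝ) ≤ 1 - b) hy, hb.1]
  set p := 1 - a + a * y with hpdef
  set q := 1 - b + b * y with hqdef
  have hmid : 1 - (a + b) / 2 + (a + b) / 2 * y = (p + q) / 2 := by rw [hpdef, hqdef]; ring
  rw [hmid] at hm ⊢
  have hpq : (q - p) ^ 2 = (b - a) ^ 2 * (y - 1) ^ 2 := by rw [hpdef, hqdef]; ring
  -- `(1 + y)^2 * v` is exactly the gap `((p + q) / 2)^2 - p * q`. As `p * q ≤ (1 + y)^2`, the
  -- squared midpoint is at least `p * q * (1 + v)`, and `v ≤ 1` gives `log (1 + v) ≥ v / 2`.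
  set v := (b - a) ^ 2 / 4 * ((y - 1) ^ 2 / (1 + y) ^ 2) with hv
  have hv0 : 0 ≤ v := by positivity
  have hh1 : (y - 1) ^ 2 / (1 + y) ^ 2 ≤ 1 := by
    rw [div_le_one (by positivity)]
    nlinarith
  have hba : (b - a) ^ 2 ≤ 1 := by
    have := ha.1; have := ha.2; have := hb.1; have := hb.2
    nlinarith
  have hv1 : v ≤ 1 := by
    have : v ≤ 1 / 4 * 1 := mul_le_mul (by linarith) hh1 (by positivity) (by norm_num)
    linarith
  have hlog : v / 2 ≤ Real.log (1 + v) := by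
    have h := Real.one_sub_inv_le_log_of_pos (by linarith : (0 : ℝ) < 1 + v)
    refine le_trans ?_ h
    have : 1 - (1 + v)⁻¹ = v / (1 + v) := by field_simp; ring
    rw [this]
    exact div_le_div_of_nonneg_left hv0 (by linarith) (by linarith)
  have hprod : p * q * (1 + v) ≤ ((p + q) / 2) ^ 2 := by
    have h1 : p * q ≤ (1 + y) ^ 2 := by
      rw [sq]; exact mul_le_mul hp1 hq1 hq.le (by linarith)
    have h2 : p * q * v ≤ (1 + y) ^ 2 * v := mul_le_mul_of_nonneg_right h1 hv0
    have h3 : (1 + y) ^ 2 * v = (q - p) ^ 2 / 4 := by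
      rw [hpq, hv]; field_simp
    nlinarith
  have hfin := Real.log_le_log (by positivity) hprod
  rw [Real.log_mul (by positivity) (by positivity), Real.log_mul hp.ne' hq.ne',
    Real.log_pow] at hfin
  push_cast at hfin
  have : (b - a) ^ 2 / 8 * ((y - 1) ^ 2 / (1 + y) ^ 2) = v / 2 := by rw [hv]; ring
  linarith

theorem growthSum_midpoint {x : ℕ → ℝ} (hx : ∀ j, 0 ≤ x j) (n : ℕ) {a b : ℝ}
    (ha : a ∈ Set.Icc (0 : ℝ) (1 / 2)) (hb : b ∈ Set.Icc (0 : ℝ) (1 / 2)) :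
    growthSum x n a + growthSum x n b +
        (b - a) ^ 2 / 8 * ∑ j ∈ Finset.range n, (x j - 1) ^ 2 / (1 + x j) ^ 2 ≤
      2 * growthSum x n ((a + b) / 2) := by
  unfold growthSum
  rw [Finset.mul_sum, Finset.mul_sum, ← Finset.sum_add_distrib, ← Finset.sum_add_distrib]
  exact Finset.sum_le_sum fun j _ => log_wealth_midpoint ha hb (hx j)

/-! ### Regret of follow-the-leader -/

/-- Betting with one step of foresight beats every constant bet in hindsight. -/
theorem growthSum_le_sum_foresight {x b : ℕ → ℝ} {s : Set ℝ} (hbs : ∀ i, b i ∈ s)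
    (hmax : ∀ i, IsMaxOn (growthSum x i) s (b i)) (n : ℕ) :
    growthSum x n (b n) ≤
      ∑ j ∈ Finset.range n, Real.log (1 - b (j + 1) + b (j + 1) * x j) := by
  induction n with
  | zero => simp [growthSum]
  | succ n ih =>
    rw [growthSum_succ, Finset.sum_range_succ]
    have : growthSum x n (b (n + 1)) ≤ growthSum x n (b n) := hmax n (hbs (n + 1))
    linarith

/-- Stability of follow-the-leader: the gain from one step of foresight is of order `1/n`. -/
theorem foresight_gain_le {x b : ℕ → ℝ} (hx : ∀ j, 0 ≤ x j)
    (hb : ∀ i, b i ∈ Set.Icc (0 : ℝ) (1 / 2))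
    (hmax : ∀ i, IsMaxOn (growthSum x i) (Set.Icc 0 (1 / 2)) (b i)) {d S : ℝ} (hd : 0 < d)
    (hS : 0 < S) {n : ℕ} (hn : d ≤ b n) (hn1 : d ≤ b (n + 1))
    (hsum : S ≤ ∑ j ∈ Finset.range n, (x j - 1) ^ 2 / (1 + x j) ^ 2) :
    0 ≤ Real.log (1 - b (n + 1) + b (n + 1) * x n) - Real.log (1 - b n + b n * x n) ∧
      Real.log (1 - b (n + 1) + b (n + 1) * x n) - Real.log (1 - b n + b n * x n) ≤
        8 / d ^ 2 / S := by
  have hmid := growthSum_midpoint hx n (hb n) (hb (n + 1))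
  have hm : growthSum x n ((b n + b (n + 1)) / 2) ≤ growthSum x n (b n) :=
    hmax n ⟨by linarith [(hb n).1, (hb (n + 1)).1], by linarith [(hb n).2, (hb (n + 1)).2]⟩
  have hnext : growthSum x (n + 1) (b n) ≤ growthSum x (n + 1) (b (n + 1)) :=
    hmax (n + 1) (hb n)
  rw [growthSum_succ, growthSum_succ] at hnext
  have hlip := log_wealth_sub_le hd ⟨hn, (hb n).2⟩ ⟨hn1, (hb (n + 1)).2⟩ (hx n)
  set g := Real.log (1 - b (n + 1) + b (n + 1) * x n) - Real.log (1 - b n + b n * x n) with hg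
  have hlow : (b (n + 1) - b n) ^ 2 / 8 * S ≤ g := by
    have := mul_le_mul_of_nonneg_left hsum
      (by positivity : 0 ≤ (b (n + 1) - b n) ^ 2 / 8)
    linarith
  have hg0 : 0 ≤ g := le_trans (by positivity) hlow
  refine ⟨hg0, ?_⟩
  rw [← sq_abs] at hlow
  rw [le_div_iff₀ hd] at hlip
  rw [div_div, le_div_iff₀ (by positivity)]
  -- With `Δ` the change of bet, the Lipschitz bound `g * d ≤ |Δ|` and strong concavity `Δ^2 * S / 8
  -- ≤ g` give `g^2 * d^2 * S ≤ 8 * g`; a positive `g` cancels.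
  rcases hg0.eq_or_lt with h0 | h0
  · rw [← h0]; norm_num
  · have h1 : (g * d) ^ 2 ≤ |b (n + 1) - b n| ^ 2 := by
      exact pow_le_pow_left₀ (by positivity) hlip 2
    have h2 : (g * d) ^ 2 * S ≤ |b (n + 1) - b n| ^ 2 * S :=
      mul_le_mul_of_nonneg_right h1 hS.le
    have h3 : g * (g * (d ^ 2 * S)) ≤ g * 8 := by nlinarith
    exact le_of_mul_le_mul_left h3 h0

/-- Deterministic growth theorem: if the average slope of the log-growth at some bet `d` is
eventually positive and the e-values are not asymptotically constant, then the wealth of the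
capped follow-the-leader strategy tends to infinity. -/
theorem tendsto_wealth_atTop {x b : ℕ → ℝ} (hx : ∀ j, 0 ≤ x j)
    (hb : ∀ i, IsCappedArgmax x i (b i)) {d c c' : ℝ} (hd : 0 < d) (hd2 : d ≤ 1 / 2)
    (hc : 0 < c) (hc' : 0 < c')
    (hslope : Tendsto (fun n : ℕ =>
      (∑ j ∈ Finset.range n, (x j - 1) / (1 - d + d * x j)) / (n : ℝ)) atTop (𝓝 c))
    (hcurv : Tendsto (fun n : ℕ =>
      (∑ j ∈ Finset.range n, (x j - 1) ^ 2 / (1 + x j) ^ 2) / (n : ℝ)) atTop (𝓝 c')) :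
    Tendsto (fun n => ∏ i ∈ Finset.range n, (1 - b i + b i * x i)) atTop atTop := by
  have hmem : ∀ i, b i ∈ Set.Icc (0 : ℝ) (1 / 2) := fun i => ((hb i).isMaxOn hx).1
  have hmax : ∀ i, IsMaxOn (growthSum x i) (Set.Icc 0 (1 / 2)) (b i) :=
    fun i => ((hb i).isMaxOn hx).2
  have hd1 : d < 1 := by linarith
  have hslope' : ∀ᶠ n : ℕ in atTop,
      c / 2 * n < ∑ j ∈ Finset.range n, (x j - 1) / (1 - d + d * x j) := by
    filter_upwards [hslope.eventually (lt_mem_nhds (half_lt_self hc)), eventually_gt_atTop 0]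
      with n h hn
    exact (lt_div_iff₀ (by positivity)).1 h
  have hcurv' : ∀ᶠ n : ℕ in atTop,
      c' / 2 * n < ∑ j ∈ Finset.range n, (x j - 1) ^ 2 / (1 + x j) ^ 2 := by
    filter_upwards [hcurv.eventually (lt_mem_nhds (half_lt_self hc')), eventually_gt_atTop 0]
      with n h hn
    exact (lt_div_iff₀ (by positivity)).1 h
  -- A leader below `d` would, by the tangent at `d` with its positive slope, have strictly less
  -- growth than `d` itself.
  have hbd : ∀ᶠ n in atTop, d ≤ b n := by
    filter_upwards [hslope'] with n h
    by_contra hlt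
    have hlt := not_le.1 hlt
    have h1 := growthSum_le hx n hd.le hd1 (hmem n).1 (hlt.trans hd1)
    have h2 : growthSum x n d ≤ growthSum x n (b n) := hmax n ⟨hd.le, hd2⟩
    have h3 : 0 < ∑ j ∈ Finset.range n, (x j - 1) / (1 - d + d * x j) :=
      lt_of_le_of_lt (by positivity) h
    nlinarith
  set g : ℕ → ℝ := fun n =>
    Real.log (1 - b (n + 1) + b (n + 1) * x n) - Real.log (1 - b n + b n * x n) with hg
  have hg0 : Tendsto g atTop (𝓝 0) := by
    have hlim : Tendsto (fun n : ℕ => 8 / d ^ 2 / (c' / 2 * (n : ℝ))) atTop (𝓝 0) :=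
      Tendsto.const_div_atTop
        (tendsto_natCast_atTop_atTop.const_mul_atTop (by positivity)) _
    have key : ∀ᶠ n : ℕ in atTop, 0 ≤ g n ∧ g n ≤ 8 / d ^ 2 / (c' / 2 * (n : ℝ)) := by
      filter_upwards [hbd, (tendsto_add_atTop_nat 1).eventually hbd, hcurv',
        eventually_gt_atTop 0] with n h1 h2 h3 h4
      exact foresight_gain_le hx hmem hmax hd (by positivity) h1 h2 h3.le
    exact squeeze_zero' (key.mono fun _ h => h.1) (key.mono fun _ h => h.2) hlim
  have hces := hg0.cesaro
  -- The tangent at `d`, evaluated at bet `0`, gives growth at least `d * c / 2 * n` for `d`; the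
  -- averaged foresight gain tends to `0` and costs at most half of that.
  have hlog : ∀ᶠ n : ℕ in atTop,
      d * c / 4 * n ≤ ∑ i ∈ Finset.range n, Real.log (1 - b i + b i * x i) := by
    have hpos : 0 < d * c / 4 := by positivity
    filter_upwards [hces.eventually (gt_mem_nhds hpos), hslope', eventually_gt_atTop 0]
      with n h1 h2 hn
    have hn' : (0 : ℝ) < n := by exact_mod_cast hn
    rw [inv_mul_lt_iff₀ hn', hg, Finset.sum_sub_distrib] at h1
    have h3 := growthSum_le_sum_foresight hmem hmax n
    have h4 : growthSum x n d ≤ growthSum x n (b n) := hmax n ⟨hd.le, hd2⟩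
    have h5 := growthSum_le hx n hd.le hd1 le_rfl zero_lt_one
    have h6 : growthSum x n 0 = 0 := by simp [growthSum]
    have h7 := mul_lt_mul_of_pos_left h2 hd
    linarith
  have hexp : Tendsto (fun n : ℕ => Real.exp (d * c / 4 * n)) atTop atTop :=
    Real.tendsto_exp_atTop.comp
      (tendsto_natCast_atTop_atTop.const_mul_atTop (by positivity))
  refine tendsto_atTop_mono' _ ?_ hexp
  filter_upwards [hlog] with n h
  have hpos : ∀ i ∈ Finset.range n, 0 < 1 - b i + b i * x i := fun i _ =>
    wealth_pos (hmem i).1 (by linarith [(hmem i).2]) (hx i)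
  rw [← Real.le_log_iff_exp_le (Finset.prod_pos hpos),
    Real.log_prod fun i hi => (hpos i hi).ne']
  exact h

/-- Positivity of `c` handles `n = 0`, where the real supremum over the empty index type is `0`. -/
theorem le_iSup_Icc_iff {f : ℕ → ℝ} {c : ℝ} (hc : 0 < c) (n : ℕ) :
    (c ≤ ⨆ t : Finset.Icc 1 n, f t) ↔ ∃ t ∈ Finset.Icc 1 n, c ≤ f t := by
  constructor
  · intro h
    rcases isEmpty_or_nonempty (Finset.Icc 1 n) with hemp | hne
    · rw [Real.iSup_of_isEmpty] at h
      exact absurd h (not_le.2 hc)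
    · obtain ⟨t, ht⟩ := exists_eq_ciSup_of_finite (f := fun t : Finset.Icc 1 n => f t)
      exact ⟨t, t.2, h.trans_eq ht.symm⟩
  · rintro ⟨t, ht, h⟩
    exact h.trans (le_ciSup (f := fun t : Finset.Icc 1 n => f t)
      (Set.finite_range _).bddAbove ⟨t, ht⟩)

/-! ### Ville's inequality by freezing the wealth -/

section Ville

variable {Ω : Type*}

/-- The wealth process frozen from the first time it reaches the level `c`. -/
noncomputable def frozenProc (E lam : ℕ → Ω → ℝ) (c : ℝ) : ℕ → Ω → ℝ
  | 0, _ => 1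
  | n + 1, ω =>
    if c ≤ frozenProc E lam c n ω then frozenProc E lam c n ω
    else frozenProc E lam c n ω * (1 - lam n ω + lam n ω * E n ω)

theorem frozenProc_nonneg {E lam : ℕ → Ω → ℝ} (hE : ∀ i ω, 0 ≤ E i ω)
    (hlam : ∀ i ω, lam i ω ∈ Set.Icc (0 : ℝ) 1) (c : ℝ) (n : ℕ) (ω : Ω) :
    0 ≤ frozenProc E lam c n ω := by
  induction n with
  | zero => exact zero_le_one
  | succ n ih =>
    rw [frozenProc]
    split_ifs
    · exact ih
    · exact mul_nonneg ih (add_nonneg (sub_nonneg.2 (hlam n ω).2)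
        (mul_nonneg (hlam n ω).1 (hE n ω)))

/-- Freezing turns a crossing at any time up to `n` into an event about time `n` alone, to which
Markov's inequality applies. -/
theorem le_frozenProc_or (E lam : ℕ → Ω → ℝ) (c : ℝ) (n : ℕ) (ω : Ω) :
    c ≤ frozenProc E lam c n ω ∨
      (frozenProc E lam c n ω = eProc E lam n ω ∧
        ∀ t ∈ Finset.Icc 1 n, eProc E lam t ω < c) := by
  induction n with
  | zero => right; simp [frozenProc, eProc]
  | succ n ih =>
    by_cases hc : c ≤ frozenProc E lam c n ω
    · left
      rwa [frozenProc, if_pos hc]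
    · obtain ⟨h1, h2⟩ := ih.resolve_left hc
      have h3 : frozenProc E lam c (n + 1) ω = eProc E lam (n + 1) ω := by
        rw [frozenProc, if_neg hc, h1, eProc, eProc, Finset.prod_range_succ]
      refine or_iff_not_imp_left.2 fun h => ⟨h3, fun t ht => ?_⟩
      rw [Finset.mem_Icc] at ht
      rcases ht.2.eq_or_lt with rfl | hlt
      · rw [← h3]; exact not_le.1 h
      · exact h2 t (Finset.mem_Icc.2 ⟨ht.1, Nat.lt_succ_iff.1 hlt⟩)

theorem comap_le_pastSigma (X : ℕ → Ω → ℝ) {i n : ℕ} (h : i < n) :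
    MeasurableSpace.comap (X i) inferInstance ≤ pastSigma X n :=
  le_iSup₂_of_le i (Finset.mem_range.2 h) le_rfl

theorem pastSigma_mono (X : ℕ → Ω → ℝ) {m n : ℕ} (h : m ≤ n) :
    pastSigma X m ≤ pastSigma X n :=
  iSup₂_le fun _ hj => comap_le_pastSigma X ((Finset.mem_range.1 hj).trans_le h)

theorem pastSigma_le [mΩ : MeasurableSpace Ω] {X : ℕ → Ω → ℝ} (hX : ∀ i, Measurable (X i))
    (n : ℕ) : pastSigma X n ≤ mΩ :=
  iSup₂_le fun j _ => (hX j).comap_le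

theorem measurable_frozenProc {X E lam : ℕ → Ω → ℝ} {e : ℝ → ℝ} (he : Measurable e)
    (hE : ∀ i ω, E i ω = e (X i ω)) (hlam : ∀ i, Measurable[pastSigma X i] (lam i))
    (c : ℝ) (n : ℕ) : Measurable[pastSigma X n] (frozenProc E lam c n) := by
  induction n with
  | zero => exact @measurable_const _ _ _ (pastSigma X 0) 1
  | succ n ih =>
    have hle := pastSigma_mono X n.le_succ
    have hEm : Measurable[pastSigma X (n + 1)] (E n) := by
      rw [show E n = e ∘ X n from funext (hE n)]
      exact he.comp ((comap_measurable (X n)).mono (comap_le_pastSigma X n.lt_succ_self) le_rfl)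
    have hF : Measurable fun p : ℝ × ℝ × ℝ =>
        if c ≤ p.1 then p.1 else p.1 * (1 - p.2.1 + p.2.1 * p.2.2) :=
      Measurable.ite (measurableSet_le measurable_const measurable_fst) (by fun_prop)
        (by fun_prop)
    exact hF.comp ((ih.mono hle le_rfl).prodMk (((hlam n).mono hle le_rfl).prodMk hEm))

theorem indep_pastSigma_comap [MeasurableSpace Ω] {Q : Measure Ω} {X : ℕ → Ω → ℝ}
    (hX : ∀ i, Measurable (X i)) (hindep : iIndepFun X Q) (n : ℕ) :
    Indep (pastSigma X n) (MeasurableSpace.comap (X n) inferInstance) Q := by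
  have h := indep_iSup_of_disjoint (fun i => (hX i).comap_le) hindep
    (S := ↑(Finset.range n)) (T := {n}) (by simp)
  simpa only [Set.mem_singleton_iff, iSup_iSup_eq_left, Finset.mem_coe] using h

/-- One step is affine in the new e-value, `A + B * E n`, with nonnegative coefficients known from
the past. Independence factors the second term, the mean bound replaces `E n` by 1, and `A + B` is
the previous wealth. This is the supermartingale property without conditional expectations. -/
theorem lintegral_frozenProc_le [MeasurableSpace Ω] {Q : Measure Ω} [IsProbabilityMeasure Q]
    {X E lam : ℕ → Ω → ℝ} (hX : ∀ i, Measurable (X i)) (hindep : iIndepFun X Q)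
    {e : ℝ → ℝ} (he : Measurable e) (he_nonneg : ∀ x, 0 ≤ e x)
    (hE : ∀ i ω, E i ω = e (X i ω)) (hlam : ∀ i, Measurable[pastSigma X i] (lam i))
    (hlam_mem : ∀ i ω, lam i ω ∈ Set.Icc (0 : ℝ) 1)
    (hmean : ∀ i, ∫⁻ ω, ENNReal.ofReal (E i ω) ∂Q ≤ 1) (c : ℝ) (n : ℕ) :
    ∫⁻ ω, ENNReal.ofReal (frozenProc E lam c n ω) ∂Q ≤ 1 := by
  have hE0 : ∀ i ω, 0 ≤ E i ω := fun i ω => hE i ω ▸ he_nonneg _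
  induction n with
  | zero => simp [frozenProc]
  | succ n ih =>
    refine le_trans ?_ ih
    have hW := measurable_frozenProc he hE hlam c n
    have hW0 := frozenProc_nonneg hE0 hlam_mem c n
    set W := frozenProc E lam c n with hWdef
    set A : Ω → ENNReal := fun ω =>
      ENNReal.ofReal (if c ≤ W ω then W ω else W ω * (1 - lam n ω)) with hA
    set B : Ω → ENNReal := fun ω =>
      ENNReal.ofReal (if c ≤ W ω then 0 else W ω * lam n ω) with hB
    have hle := pastSigma_le hX n
    have hAm : Measurable[pastSigma X n] A := by
      have hF : Measurable fun p : ℝ × ℝ =>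
          ENNReal.ofReal (if c ≤ p.1 then p.1 else p.1 * (1 - p.2)) :=
        (Measurable.ite (measurableSet_le measurable_const measurable_fst) (by fun_prop)
          (by fun_prop)).ennreal_ofReal
      exact hF.comp (hW.prodMk (hlam n))
    have hBm : Measurable[pastSigma X n] B := by
      have hF : Measurable fun p : ℝ × ℝ =>
          ENNReal.ofReal (if c ≤ p.1 then 0 else p.1 * p.2) :=
        (Measurable.ite (measurableSet_le measurable_const measurable_fst) (by fun_prop)
          (by fun_prop)).ennreal_ofReal
      exact hF.comp (hW.prodMk (hlam n))
    have hEm : Measurable[MeasurableSpace.comap (X n) inferInstance]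
        fun ω => ENNReal.ofReal (E n ω) := by
      rw [show (fun ω => ENNReal.ofReal (E n ω)) = (fun y => ENNReal.ofReal (e y)) ∘ X n from
        funext fun ω => congrArg ENNReal.ofReal (hE n ω)]
      exact he.ennreal_ofReal.comp (comap_measurable (X n))
    have hstep : ∀ ω, ENNReal.ofReal (frozenProc E lam c (n + 1) ω) =
        A ω + B ω * ENNReal.ofReal (E n ω) := by
      intro ω
      have h1 := hW0 ω
      have h2 := (hlam_mem n ω).1
      have h3 := sub_nonneg.2 (hlam_mem n ω).2
      have h4 := hE0 n ω
      rw [frozenProc, ← hWdef, hA, hB]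
      dsimp only
      split_ifs
      · simp
      · rw [← ENNReal.ofReal_mul (by positivity), ← ENNReal.ofReal_add (by positivity)
          (by positivity)]
        congr 1
        ring
    have hsplit : ∀ ω, A ω + B ω = ENNReal.ofReal (W ω) := by
      intro ω
      have h1 := hW0 ω
      have h2 := (hlam_mem n ω).1
      have h3 := sub_nonneg.2 (hlam_mem n ω).2
      rw [hA, hB]
      dsimp only
      split_ifs
      · simp
      · rw [← ENNReal.ofReal_add (by positivity) (by positivity)]
        congr 1
        ring
    calc ∫⁻ ω, ENNReal.ofReal (frozenProc E lam c (n + 1) ω) ∂Q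
        = ∫⁻ ω, A ω ∂Q + ∫⁻ ω, B ω * ENNReal.ofReal (E n ω) ∂Q := by
          rw [← lintegral_add_left (hAm.mono hle le_rfl)]
          exact lintegral_congr hstep
      _ = ∫⁻ ω, A ω ∂Q + (∫⁻ ω, B ω ∂Q) * ∫⁻ ω, ENNReal.ofReal (E n ω) ∂Q := by
          rw [lintegral_mul_eq_lintegral_mul_lintegral_of_independent_measurableSpace hle
            (hX n).comap_le (indep_pastSigma_comap hX hindep n) hBm hEm]
      _ ≤ ∫⁻ ω, A ω ∂Q + (∫⁻ ω, B ω ∂Q) * 1 := by gcongr; exact hmean n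
      _ = ∫⁻ ω, ENNReal.ofReal (W ω) ∂Q := by
          rw [mul_one, ← lintegral_add_left (hAm.mono hle le_rfl)]
          exact lintegral_congr hsplit

/-- Ville's inequality for the wealth of a predictable bet on iid e-values of mean at most `1`. -/
theorem measure_exists_le_eProc_le [MeasurableSpace Ω] {Q : Measure Ω} [IsProbabilityMeasure Q]
    {X E lam : ℕ → Ω → ℝ} (hX : ∀ i, Measurable (X i)) (hindep : iIndepFun X Q)
    {e : ℝ → ℝ} (he : Measurable e) (he_nonneg : ∀ x, 0 ≤ e x)
    (hE : ∀ i ω, E i ω = e (X i ω)) (hlam : ∀ i, Measurable[pastSigma X i] (lam i))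
    (hlam_mem : ∀ i ω, lam i ω ∈ Set.Icc (0 : ℝ) 1)
    (hmean : ∀ i, ∫⁻ ω, ENNReal.ofReal (E i ω) ∂Q ≤ 1) {c : ℝ} (hc : 0 < c) (n : ℕ) :
    Q {ω | ∃ t ∈ Finset.Icc 1 n, c ≤ eProc E lam t ω} ≤ (ENNReal.ofReal c)⁻¹ := by
  have hW := (measurable_frozenProc he hE hlam c n).mono (pastSigma_le hX n) le_rfl
  have hsub : {ω | ∃ t ∈ Finset.Icc 1 n, c ≤ eProc E lam t ω} ⊆
      {ω | ENNReal.ofReal c ≤ ENNReal.ofReal (frozenProc E lam c n ω)} := by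
    rintro ω ⟨t, ht, h⟩
    refine ENNReal.ofReal_le_ofReal ?_
    exact (le_frozenProc_or E lam c n ω).resolve_right fun h' => (h'.2 t ht).not_ge h
  have hmarkov := mul_meas_ge_le_lintegral (μ := Q) hW.ennreal_ofReal (ENNReal.ofReal c)
  have hle := hmarkov.trans
    (lintegral_frozenProc_le hX hindep he he_nonneg hE hlam hlam_mem hmean c n)
  refine (measure_mono hsub).trans ?_
  rw [← one_div, ENNReal.le_div_iff_mul_le (Or.inl (by simpa using hc))
    (Or.inl ENNReal.ofReal_ne_top), mul_comm]
  exact hle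

end Ville

/-! ### Strong law and almost sure growth when the mean exceeds 1 -/

section Growth

variable {Ω : Type*} [MeasurableSpace Ω] {Q : Measure Ω}

theorem ae_tendsto_average_comp {X : ℕ → Ω → ℝ} (hindep : iIndepFun X Q)
    (hident : ∀ i, IdentDistrib (X i) (X 0) Q Q) {f : ℝ → ℝ} (hf : Measurable f)
    (hint : Integrable (fun ω => f (X 0 ω)) Q) :
    ∀ᵐ ω ∂Q, Tendsto (fun n : ℕ => (∑ j ∈ Finset.range n, f (X j ω)) / (n : ℝ)) atTop
      (𝓝 (∫ ω, f (X 0 ω) ∂Q)) :=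
  strong_law_ae_real (fun i ω => f (X i ω)) hint
    (fun _ _ hij => (hindep.indepFun hij).comp hf hf) fun i => (hident i).comp hf

theorem slope_bounds {d y : ℝ} (hd : 0 < d) (hd2 : d ≤ 1 / 2) (hy : 0 ≤ y) :
    -2 ≤ (y - 1) / (1 - d + d * y) ∧ (y - 1) / (1 - d + d * y) ≤ 1 / d := by
  have hp := wealth_pos hd.le (by linarith) hy
  constructor
  · rw [le_div_iff₀ hp]
    nlinarith [mul_nonneg hd.le hy]
  · rw [div_le_div_iff₀ hp hd]
    nlinarith

/-- For fixed `d > 0` the slope is bounded even when `Y` has infinite mean, which is what makes the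
strong law available. -/
theorem integrable_slope [IsProbabilityMeasure Q] {Y : Ω → ℝ} (hY : Measurable Y)
    (hY0 : ∀ ω, 0 ≤ Y ω) {d : ℝ} (hd : 0 < d) (hd2 : d ≤ 1 / 2) :
    Integrable (fun ω => (Y ω - 1) / (1 - d + d * Y ω)) Q := by
  refine Integrable.of_bound (C := max 2 (1 / d))
    (Measurable.aestronglyMeasurable (by fun_prop)) (ae_of_all _ fun ω => ?_)
  obtain ⟨h1, h2⟩ := slope_bounds hd hd2 (hY0 ω)
  rw [Real.norm_eq_abs, abs_le]
  exact ⟨by linarith [le_max_left 2 (1 / d)], h2.trans (le_max_right _ _)⟩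

/-- If the mean exceeds `1`, the expected log-growth has positive slope at some small bet. -/
theorem exists_integral_slope_pos [IsProbabilityMeasure Q] {Y : Ω → ℝ} (hY : Measurable Y)
    (hY0 : ∀ ω, 0 ≤ Y ω) (hmean : 1 < ∫⁻ ω, ENNReal.ofReal (Y ω) ∂Q) :
    ∃ d : ℝ, 0 < d ∧ d ≤ 1 / 2 ∧ 0 < ∫ ω, (Y ω - 1) / (1 - d + d * Y ω) ∂Q := by
  set δ : ℕ → ℝ := fun n => 1 / ((n : ℝ) + 2) with hδ
  have hδ0 : ∀ n, 0 < δ n := fun n => by simp only [hδ]; positivity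
  have hδ2 : ∀ n, δ n ≤ 1 / 2 := fun n =>
    one_div_le_one_div_of_le two_pos (by linarith [n.cast_nonneg (α := ℝ)])
  have hanti : Antitone δ := fun m n h =>
    one_div_le_one_div_of_le (by positivity) (by gcongr)
  have hlimδ : Tendsto δ atTop (𝓝 0) :=
    tendsto_const_nhds.div_atTop
      (tendsto_atTop_add_const_right _ _ tendsto_natCast_atTop_atTop)
  have hmono : ∀ ω, Monotone fun n => (Y ω - 1) / (1 - δ n + δ n * Y ω) := by
    intro ω m n h
    have hp := wealth_pos (hδ0 m).le (by linarith [hδ2 m]) (hY0 ω)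
    have hq := wealth_pos (hδ0 n).le (by linarith [hδ2 n]) (hY0 ω)
    dsimp only
    rw [div_le_div_iff₀ hp hq]
    -- After cross-multiplication the difference of the two sides is `(δ m - δ n) * (Y ω - 1)^2`.
    nlinarith [mul_nonneg (sub_nonneg.2 (hanti h)) (sq_nonneg (Y ω - 1))]
  have hlim : ∀ ω, Tendsto (fun n => (Y ω - 1) / (1 - δ n + δ n * Y ω)) atTop
      (𝓝 (Y ω - 1)) := by
    intro ω
    have hden : Tendsto (fun n => 1 - δ n + δ n * Y ω) atTop (𝓝 1) := by
      simpa using (hlimδ.const_sub 1).add (hlimδ.mul_const (Y ω))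
    have h : Tendsto (fun n => (Y ω - 1) / (1 - δ n + δ n * Y ω)) atTop (𝓝 ((Y ω - 1) / 1)) :=
      tendsto_const_nhds.div hden one_ne_zero
    rwa [div_one] at h
  -- Slopes are at least `-2`, so adding `2` makes them nonnegative and monotone convergence covers
  -- an infinite mean as well.
  have hL : Tendsto
      (fun n => ∫⁻ ω, ENNReal.ofReal ((Y ω - 1) / (1 - δ n + δ n * Y ω) + 2) ∂Q) atTop
      (𝓝 (∫⁻ ω, ENNReal.ofReal (Y ω - 1 + 2) ∂Q)) := by
    refine lintegral_tendsto_of_tendsto_of_monotone (fun n => ?_) (ae_of_all _ fun ω m n h => ?_)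
      (ae_of_all _ fun ω => ?_)
    · exact Measurable.aemeasurable (by fun_prop)
    · exact ENNReal.ofReal_le_ofReal (by linarith [hmono ω h])
    · exact ENNReal.tendsto_ofReal ((hlim ω).add_const 2)
  have h2 : (2 : ENNReal) < ∫⁻ ω, ENNReal.ofReal (Y ω - 1 + 2) ∂Q := by
    have : ∀ ω, ENNReal.ofReal (Y ω - 1 + 2) = ENNReal.ofReal (Y ω) + 1 := fun ω => by
      rw [← ENNReal.ofReal_one, ← ENNReal.ofReal_add (hY0 ω) zero_le_one]
      congr 1
      ring
    rw [lintegral_congr this, lintegral_add_right _ measurable_const, lintegral_const,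
      measure_univ, mul_one, ← one_add_one_eq_two]
    exact ENNReal.add_lt_add_right ENNReal.one_ne_top hmean
  obtain ⟨n, hn⟩ := (hL.eventually (lt_mem_nhds h2)).exists
  refine ⟨δ n, hδ0 n, hδ2 n, ?_⟩
  have hint := integrable_slope (Q := Q) hY hY0 (hδ0 n) (hδ2 n)
  have hint2 : Integrable (fun ω => (Y ω - 1) / (1 - δ n + δ n * Y ω) + 2) Q :=
    hint.add (integrable_const 2)
  have hnn : ∀ ω, 0 ≤ (Y ω - 1) / (1 - δ n + δ n * Y ω) + 2 := fun ω => by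
    linarith [(slope_bounds (hδ0 n) (hδ2 n) (hY0 ω)).1]
  rw [← ofReal_integral_eq_lintegral_ofReal hint2 (ae_of_all _ hnn),
    integral_add hint (integrable_const 2), integral_const, probReal_univ, one_smul,
    show (2 : ENNReal) = ENNReal.ofReal 2 by simp,
    ENNReal.ofReal_lt_ofReal_iff_of_nonneg two_pos.le] at hn
  linarith

theorem integrable_curvature [IsProbabilityMeasure Q] {Y : Ω → ℝ} (hY : Measurable Y)
    (hY0 : ∀ ω, 0 ≤ Y ω) : Integrable (fun ω => (Y ω - 1) ^ 2 / (1 + Y ω) ^ 2) Q := by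
  refine Integrable.of_bound (C := 1)
    (Measurable.aestronglyMeasurable (by fun_prop)) (ae_of_all _ fun ω => ?_)
  have := hY0 ω
  rw [Real.norm_eq_abs, abs_of_nonneg (by positivity), div_le_one (by positivity)]
  nlinarith

/-- A vanishing integral would force `Y = 1` almost surely, hence mean 1. -/
theorem integral_curvature_pos [IsProbabilityMeasure Q] {Y : Ω → ℝ} (hY : Measurable Y)
    (hY0 : ∀ ω, 0 ≤ Y ω) (hmean : 1 < ∫⁻ ω, ENNReal.ofReal (Y ω) ∂Q) :
    0 < ∫ ω, (Y ω - 1) ^ 2 / (1 + Y ω) ^ 2 ∂Q := by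
  have hnn : ∀ ω, 0 ≤ (Y ω - 1) ^ 2 / (1 + Y ω) ^ 2 := fun ω => by positivity
  refine lt_of_le_of_ne (integral_nonneg hnn) fun h0 => hmean.ne' ?_
  have h := (integral_eq_zero_iff_of_nonneg hnn (integrable_curvature hY hY0)).1 h0.symm
  have h1 : ∀ᵐ ω ∂Q, ENNReal.ofReal (Y ω) = 1 := by
    filter_upwards [h] with ω hω
    have hp : (1 + Y ω) ^ 2 ≠ 0 := by have := hY0 ω; positivity
    have h2 : (Y ω - 1) ^ 2 = 0 := (div_eq_zero_iff.1 hω).resolve_right hp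
    rw [sub_eq_zero.1 (pow_eq_zero_iff two_ne_zero |>.1 h2), ENNReal.ofReal_one]
  rw [lintegral_congr_ae h1]
  simp

theorem ae_tendsto_eProc_atTop [IsProbabilityMeasure Q] {X E lam : ℕ → Ω → ℝ}
    (hX : ∀ i, Measurable (X i)) (hindep : iIndepFun X Q)
    (hident : ∀ i, IdentDistrib (X i) (X 0) Q Q) {e : ℝ → ℝ} (he : Measurable e)
    (he_nonneg : ∀ x, 0 ≤ e x) (hE : ∀ i ω, E i ω = e (X i ω)) (hlam : IsEGree X E lam)
    (hmean : 1 < ∫⁻ ω, ENNReal.ofReal (E 0 ω) ∂Q) :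
    ∀ᵐ ω ∂Q, Tendsto (fun n => eProc E lam n ω) atTop atTop := by
  have hY : Measurable fun ω => e (X 0 ω) := he.comp (hX 0)
  have hY0 : ∀ ω, 0 ≤ e (X 0 ω) := fun ω => he_nonneg _
  simp only [hE] at hmean
  obtain ⟨d, hd, hd2, hslope⟩ := exists_integral_slope_pos hY hY0 hmean
  filter_upwards [ae_tendsto_average_comp hindep hident
      (f := fun z => (e z - 1) / (1 - d + d * e z)) (by fun_prop) (integrable_slope hY hY0 hd hd2),
    ae_tendsto_average_comp hindep hident
      (f := fun z => (e z - 1) ^ 2 / (1 + e z) ^ 2) (by fun_prop) (integrable_curvature hY hY0)]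
    with ω h1 h2
  refine tendsto_wealth_atTop (x := fun j => E j ω) (b := fun j => lam j ω)
    (fun j => hE j ω ▸ he_nonneg _) (fun i => (hlam i).2 ω) hd hd2 hslope
    (integral_curvature_pos hY hY0 hmean) ?_ ?_
  · simpa only [hE] using h1
  · simpa only [hE] using h2

end Growth

/-! ### The equivalence -/

theorem mainTheorem6 {Ω : Type*} [MeasurableSpace Ω] (Q : Measure Ω) [IsProbabilityMeasure Q]
    (X : ℕ → Ω → ℝ) (hX : ∀ i, Measurable (X i))
    (hindep : iIndepFun X Q) (hident : ∀ i, IdentDistrib (X i) (X 0) Q Q)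
    (e : ℝ → ℝ) (he : Measurable e) (he_nonneg : ∀ x, 0 ≤ e x)
    (E : ℕ → Ω → ℝ) (hE : ∀ i ω, E i ω = e (X i ω))
    (lam : ℕ → Ω → ℝ) (hlam : IsEGree X E lam) :
    (∀ α ∈ Set.Ioo (0 : ℝ) 1,
      Tendsto (fun n : ℕ => Q {ω | 1 / α ≤ ⨆ t : Finset.Icc 1 n, eProc E lam t ω})
        atTop (𝓝 1)) ↔
      1 < ∫⁻ ω, ENNReal.ofReal (E 0 ω) ∂Q := by
  have hset : ∀ α ∈ Set.Ioo (0 : ℝ) 1, ∀ n,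
      {ω | 1 / α ≤ ⨆ t : Finset.Icc 1 n, eProc E lam t ω} =
        {ω | ∃ t ∈ Finset.Icc 1 n, 1 / α ≤ eProc E lam t ω} := fun α hα n =>
    Set.ext fun ω =>
      le_iSup_Icc_iff (f := fun t => eProc E lam t ω) (one_div_pos.2 hα.1) n
  have hE0 : ∀ i ω, 0 ≤ E i ω := fun i ω => hE i ω ▸ he_nonneg _
  constructor
  · intro h
    by_contra hmean
    have hmean_le : ∀ i, ∫⁻ ω, ENNReal.ofReal (E i ω) ∂Q ≤ 1 := fun i => by
      refine le_of_eq_of_le ?_ (not_lt.1 hmean)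
      simp only [hE]
      exact ((hident i).comp he.ennreal_ofReal).lintegral_eq
    have hmem : ∀ i ω, lam i ω ∈ Set.Icc (0 : ℝ) 1 := fun i ω => by
      have := (((hlam i).2 ω).isMaxOn fun j => hE0 j ω).1
      exact ⟨this.1, this.2.trans (by norm_num)⟩
    -- One level suffices: at `α = 1/2` Ville's bound is `1/2` for every `n`, which contradicts the
    -- limit `1`.
    have hhalf : (1 / 2 : ℝ) ∈ Set.Ioo (0 : ℝ) 1 := by norm_num
    have hle : (1 : ENNReal) ≤ (ENNReal.ofReal (1 / (1 / 2)))⁻¹ := by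
      refine le_of_tendsto' (h _ hhalf) fun n => ?_
      rw [hset _ hhalf]
      exact measure_exists_le_eProc_le hX hindep he he_nonneg hE (fun i => (hlam i).1) hmem
        hmean_le (by norm_num) n
    norm_num at hle
  · intro hmean α hα
    simp only [hset α hα]
    have hmono : Monotone fun n => {ω | ∃ t ∈ Finset.Icc 1 n, 1 / α ≤ eProc E lam t ω} :=
      fun m n hmn ω ⟨t, ht, h⟩ => ⟨t, Finset.Icc_subset_Icc_right hmn ht, h⟩
    -- Continuity from below: the limit is the probability of ever crossing, which is 1 since the
    -- wealth diverges almost surely.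
    have hlim := tendsto_measure_iUnion_atTop (μ := Q) hmono
    have hfull : Q (⋃ n, {ω | ∃ t ∈ Finset.Icc 1 n, 1 / α ≤ eProc E lam t ω}) = 1 := by
      rw [← measure_univ (μ := Q)]
      refine measure_congr (eventuallyEq_univ.2 ?_)
      filter_upwards [ae_tendsto_eProc_atTop hX hindep hident he he_nonneg hE hlam hmean]
        with ω hω
      obtain ⟨t, ht, ht1⟩ :=
        ((hω.eventually_ge_atTop (1 / α)).and (eventually_ge_atTop 1)).exists
      exact Set.mem_iUnion.2 ⟨t, t, Finset.mem_Icc.2 ⟨ht1, le_rfl⟩, ht⟩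
    rwa [hfull] at hlim
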